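/- **Setting.** Consider the system $x_{k+1}=Ax_k+Bu_k$, $y_k=Cx_k+Du_k$ with $x_k\in\mathbb R^n$, $u_k\in\mathbb R^m$, $y_k\in\mathbb R^p$, where $(A,B)$ is controllable and $(A,C)$ is observable. Let $\underline l$ be its lag, i.e. the smallest $j\in\{1,\dots,n\}$ such that the matrix with block rows $C,CA,\dots,CA^{j-1}$ has rank $n$, and let $l\ge\underline l$, $L\ge1$. For an input-output sequence let $\xi_t=(u_{t-l},\dots,u_{t-1},y_{t-l},\dots,y_{t-1})\in\mathbb R^{(m+p)l}$ be the extended state, and let $F_i,G_i$ ($1\le i\le l$) be matrices such that $y_k=\sum_{i=1}^l(F_iy_{k-i}+G_iu_{k-i})+Du_k$ along every trajectory of the system. Write the resulting dynamics of the extended state as $\xi_{k+1}=\tilde A\xi_k+\tilde Bu_k$, $y_k=\tilde C\xi_k+\tilde Du_k$, where $\tilde A,\tilde B$ consist of the block shifts and of the rows $(G_l,\dots,G_1,F_l,\dots,F_1)=\tilde C$ and $D=\tilde D$. Let $\mathbb U\subseteq\mathbb R^m$, $\mathbb Y\subseteq\mathbb R^p$, and let $(u^s,y^s)\in\mathrm{int}(\mathbb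 U\times\mathbb Y)$ be an equilibrium, i.e. the constant sequence $(u^s,y^s)$ of length $\underline l+1$ is a trajectory of the system; let $\xi^s=(u^s,\dots,u^s,y^s,\dots,y^s)$. Let $Q\succ0$, $R\succ0$, and let $\{u^d_k,y^d_k\}_{k=0}^{N-1}$ be a trajectory of the system. $H_T(v)$ denotes the Hankel matrix with $T$ block rows of $\{v_k\}_{k=0}^{N-1}$; $v$ is persistently exciting of order $T$ if $H_T(v)$ has full row rank. Write $\|x\|_P^2=x^\top Px$. **MPC problem.** For a given $\xi\in\mathbb R^{(m+p)l}$, minimize $$\sum_{k=0}^{L-1}\big(\|\bar u_k-u^s\|_R^2+\|\bar y_k-y^s\|_Q^2\big)+\|\bar\xi_L-\xi^s\|_P^2$$ over $\alpha\in\mathbb R^{N-L-l+1}$ and $\bar u_{-l},\dots,\bar u_{L-1}$, $\bar y_{-l},\dots,\bar y_{L-1}$, subject to $\bar u_{[-l,L-1]}=H_{L+l}(u^d)\alpha$, $\bar y_{[-l,L-1]}=H_{L+l}(y^d)\alpha$, $(\bar u_{[-l,-1]},\bar y_{[-l,-1]})=\xi$, $\bar\xi_L:=(\bar u_{[L-l,L-1]},\bar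 y_{[L-l,L-1]})\in\Xi_f$, and $\bar u_k\in\mathbb U$, $\bar y_k\in\mathbb Y$ for $0\le k\le L-1$. Let $J_L^*(\xi)$ be the optimal cost. In closed loop, the system runs from time $-l$ on, and at every time $t\ge0$ at which the problem with $\xi=\xi_t$ is feasible, the input $u_t=\bar u_0^*$ of some optimal solution (assumed to exist) is applied. **Assumption 1.** $P=P^\top\succ0$, $K\in\mathbb R^{m\times(m+p)l}$ and $\Xi_f\subseteq\mathbb U^l\times\mathbb Y^l$ with $\xi^s\in\mathrm{int}(\Xi_f)$ are such that for all $\xi\in\Xi_f$, with $u=u^s+K(\xi-\xi^s)$ and $y=\tilde C\xi+\tilde Du$: (i) $\tilde A\xi+\tilde Bu\in\Xi_f$; (ii) $u\in\mathbb U$ and $y\in\mathbb Y$; (iii) $\|(\tilde A+\tilde BK)(\xi-\xi^s)\|_P^2\le\|\xi-\xi^s\|_P^2-\|\xi-\xi^s\|_{K^\top RK}^2-\|y-y^s\|_Q^2$. **Assumption 2.** There is $c_u>0$ such that $J_L^*(\xi)\le c_u\|\xi-\xi^s\|_2^2$ for all $\xi$ for which the MPC problem is feasible. **Theorem.** Suppose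 that Assumptions 1 and 2 hold and that $u^d$ is persistently exciting of order $L+l+n$. If the MPC problem is feasible at time $t=0$, then in closed loop (i) it is feasible at every time $t\ge0$; (ii) $u_t\in\mathbb U$ and $y_t\in\mathbb Y$ for all $t\ge0$; (iii) $\xi^s$ is exponentially stable: there are $c>0$ and $\rho\in(0,1)$ such that $\|\xi_t-\xi^s\|_2\le c\,\rho^t\,\|\xi_0-\xi^s\|_2$ for all $t\ge0$ and for every closed-loop run whose initial extended state $\xi_0$ makes the problem feasible. Moreover, the problem is feasible for every $\xi_0$ in some neighborhood of $\xi^s$ that is generated by the system. -/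

import Mathlib

namespace DDMPC

open Matrix

/-! ### Linear systems, trajectories, persistence of excitation -/

/-- The matrices of `x⁺ = A x + B u`, `y = C x + D u` with state in `ℝⁿ`, input in `ℝᵐ`,
output in `ℝᵖ`. -/
structure LTI (n m p : ℕ) where
  A : Matrix (Fin n) (Fin n) ℝ
  B : Matrix (Fin n) (Fin m) ℝ
  C : Matrix (Fin p) (Fin n) ℝ
  D : Matrix (Fin p) (Fin m) ℝ

/-- `[B, A B, …, A^(n-1) B]`. -/
def LTI.ctrbMatrix {n m p : ℕ} (S : LTI n m p) : Matrix (Fin n) (Fin n × Fin m) ℝ :=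
  Matrix.of fun i ka => (S.A ^ (ka.1 : ℕ) * S.B) i ka.2

/-- The observability matrix `Φ_j`, with block rows `C, C A, …, C A^(j-1)`. -/
def LTI.obsvMatrix {n m p : ℕ} (S : LTI n m p) (j : ℕ) : Matrix (Fin j × Fin p) (Fin n) ℝ :=
  Matrix.of fun ka i => (S.C * S.A ^ (ka.1 : ℕ)) ka.2 i

def LTI.Controllable {n m p : ℕ} (S : LTI n m p) : Prop := S.ctrbMatrix.rank = n

def LTI.Observable {n m p : ℕ} (S : LTI n m p) : Prop := (S.obsvMatrix n).rank = n

/-- `l₀` is the lag: the smallest `j ∈ {1, …, n}` such that `Φ_j` has rank `n`. -/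
def LTI.IsLag {n m p : ℕ} (S : LTI n m p) (l₀ : ℕ) : Prop :=
  IsLeast {j : ℕ | 1 ≤ j ∧ j ≤ n ∧ (S.obsvMatrix j).rank = n} l₀

/-- State, input and output satisfy the system equations at time `k`. -/
def LTI.StepAt {n m p : ℕ} (S : LTI n m p) (x : ℕ → Fin n → ℝ) (u : ℕ → Fin m → ℝ)
    (y : ℕ → Fin p → ℝ) (k : ℕ) : Prop :=
  x (k + 1) = S.A *ᵥ x k + S.B *ᵥ u k ∧ y k = S.C *ᵥ x k + S.D *ᵥ u k

/-- The first `T` entries of `u`, `y` form an input-output trajectory of length `T`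
(later entries are irrelevant). -/
def LTI.IsTrajectory {n m p : ℕ} (S : LTI n m p) (T : ℕ) (u : ℕ → Fin m → ℝ)
    (y : ℕ → Fin p → ℝ) : Prop :=
  ∃ x : ℕ → Fin n → ℝ, ∀ k < T, S.StepAt x u y k

/-- `(us, ys)` is an input-output equilibrium: the constant sequence of length `l₀ + 1`, with
`l₀` the lag, is a trajectory. -/
def LTI.IsEquilibrium {n m p : ℕ} (S : LTI n m p) (l₀ : ℕ) (us : Fin m → ℝ)
    (ys : Fin p → ℝ) : Prop :=
  S.IsTrajectory (l₀ + 1) (fun _ => us) (fun _ => ys)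

/-- The Hankel matrix `H_T` of the first `N` entries of `v`, with block entries `v (i + j)`;
there are `N - T + 1` columns, and none if `N < T`. -/
def hankel {q : ℕ} (T N : ℕ) (v : ℕ → Fin q → ℝ) :
    Matrix (Fin T × Fin q) (Fin (N + 1 - T)) ℝ :=
  Matrix.of fun ia j => v ((ia.1 : ℕ) + (j : ℕ)) ia.2

/-- The stacked vector of the first `T` entries of `v`. -/
def stack {q : ℕ} (T : ℕ) (v : ℕ → Fin q → ℝ) : Fin T × Fin q → ℝ :=
  fun ia => v ia.1 ia.2

/-- The first `N` entries of `v` are persistently exciting of order `T`. -/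
def PersistentlyExciting {q : ℕ} (T N : ℕ) (v : ℕ → Fin q → ℝ) : Prop :=
  (hankel T N v).rank = q * T

/-! ### Extended state -/

/-- Index type of the extended state: `l` input blocks, then `l` output blocks, oldest first. -/
abbrev ExtIdx (l m p : ℕ) : Type := (Fin l × Fin m) ⊕ (Fin l × Fin p)

/-- The window `(u_[t, t+l-1], y_[t, t+l-1])` as a stacked vector. -/
def window (l : ℕ) {m p : ℕ} (u : ℕ → Fin m → ℝ) (y : ℕ → Fin p → ℝ) (t : ℕ) :
    ExtIdx l m p → ℝ :=
  Sum.elim (fun ia => u (t + (ia.1 : ℕ)) ia.2) (fun ia => y (t + (ia.1 : ℕ)) ia.2)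

/-- The stacked constant setpoint. -/
def constExt (l : ℕ) {m p : ℕ} (us : Fin m → ℝ) (ys : Fin p → ℝ) : ExtIdx l m p → ℝ :=
  window l (fun _ => us) (fun _ => ys) 0

/-- `x ↦ xᵀ P x`. -/
def wsq {ι : Type*} [Fintype ι] (P : Matrix ι ι ℝ) (x : ι → ℝ) : ℝ := x ⬝ᵥ (P *ᵥ x)

/-- The Euclidean norm. -/
noncomputable def norm2 {ι : Type*} [Fintype ι] (x : ι → ℝ) : ℝ := ‖WithLp.toLp 2 x‖

/-- The block shift, with identity blocks on the upper block diagonal. -/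
def shiftMatrix (l q : ℕ) : Matrix (Fin l × Fin q) (Fin l × Fin q) ℝ :=
  Matrix.of fun ia jb => if (jb.1 : ℕ) = (ia.1 : ℕ) + 1 ∧ ia.2 = jb.2 then 1 else 0

/-- The block row `[M_l, M_(l-1), …, M_1]`. -/
def coeffRow (l : ℕ) {p q : ℕ} (M : ℕ → Matrix (Fin p) (Fin q) ℝ) :
    Matrix (Fin p) (Fin l × Fin q) ℝ :=
  Matrix.of fun a jb => M (l - (jb.1 : ℕ)) a jb.2

/-- The block column `[0, …, 0, M]` with `l` blocks. -/
def lastBlock (l : ℕ) {q : ℕ} {κ : Type*} (M : Matrix (Fin q) κ ℝ) :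
    Matrix (Fin l × Fin q) κ ℝ :=
  Matrix.of fun ia j => if (ia.1 : ℕ) + 1 = l then M ia.2 j else 0

/-- The coefficients `F_1, …, F_l`, `G_1, …, G_l` (other indices are irrelevant) and `D` of
`y_k = ∑ i, (F_i y_(k-i) + G_i u_(k-i)) + D u_k`. -/
structure ARX (m p : ℕ) where
  F : ℕ → Matrix (Fin p) (Fin p) ℝ
  G : ℕ → Matrix (Fin p) (Fin m) ℝ
  D : Matrix (Fin p) (Fin m) ℝ

/-- `Ã`. -/
def ARX.At {m p : ℕ} (E : ARX m p) (l : ℕ) : Matrix (ExtIdx l m p) (ExtIdx l m p) ℝ :=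
  Matrix.fromBlocks (shiftMatrix l m) 0
    (lastBlock l (coeffRow l E.G)) (shiftMatrix l p + lastBlock l (coeffRow l E.F))

/-- `B̃`. -/
def ARX.Bt {m p : ℕ} (E : ARX m p) (l : ℕ) : Matrix (ExtIdx l m p) (Fin m) ℝ :=
  Matrix.fromRows (lastBlock l (1 : Matrix (Fin m) (Fin m) ℝ)) (lastBlock l E.D)

/-- `C̃`. -/
def ARX.Ct {m p : ℕ} (E : ARX m p) (l : ℕ) : Matrix (Fin p) (ExtIdx l m p) ℝ :=
  Matrix.fromCols (coeffRow l E.G) (coeffRow l E.F)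

/-- `D̃`. -/
def ARX.Dt {m p : ℕ} (E : ARX m p) : Matrix (Fin p) (Fin m) ℝ := E.D

/-- The extended-state equations `ξ⁺ = Ã ξ + B̃ u`, `y = C̃ ξ + D̃ u` hold along every
trajectory of the system. By time invariance it suffices to ask this at one time step. -/
def ARX.Describes {n m p : ℕ} (E : ARX m p) (l : ℕ) (S : LTI n m p) : Prop :=
  E.D = S.D ∧
  ∀ (u : ℕ → Fin m → ℝ) (y : ℕ → Fin p → ℝ), S.IsTrajectory (l + 1) u y →
    window l u y 1 = E.At l *ᵥ window l u y 0 + E.Bt l *ᵥ u l ∧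
    y l = E.Ct l *ᵥ window l u y 0 + E.Dt *ᵥ u l

/-! ### The optimal control problem -/

/-- The data of the optimal control problem: measured data `ud`, `yd` (the first `N` entries),
weights `Q`, `R`, `P`, constraint sets `U`, `Y`, terminal set `Xf`, setpoint `(us, ys)`.
`l` is the length of the initial condition and `L` is the horizon. -/
structure MPC (m p l L N : ℕ) where
  ud : ℕ → Fin m → ℝ
  yd : ℕ → Fin p → ℝ
  Q : Matrix (Fin p) (Fin p) ℝ
  R : Matrix (Fin m) (Fin m) ℝ
  P : Matrix (ExtIdx l m p) (ExtIdx l m p) ℝ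
  U : Set (Fin m → ℝ)
  Y : Set (Fin p → ℝ)
  Xf : Set (ExtIdx l m p → ℝ)
  us : Fin m → ℝ
  ys : Fin p → ℝ

namespace MPC

variable {m p l L N : ℕ}

/-- The setpoint of the extended state. -/
def xis (M : MPC m p l L N) : ExtIdx l m p → ℝ := constExt l M.us M.ys

/-- Decision variables. The entry with index `l + k` of `u`, `y` is the prediction for step `k`,
where `k` runs from `-l` to `L - 1`; entries with index `≥ L + l` are irrelevant. -/
structure Decision (m p l L N : ℕ) where
  α : Fin (N + 1 - (L + l)) → ℝ
  u : ℕ → Fin m → ℝ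
  y : ℕ → Fin p → ℝ

/-- `d` satisfies all constraints of the problem with initial condition `ξ`. -/
structure IsFeasible (M : MPC m p l L N) (ξ : ExtIdx l m p → ℝ) (d : Decision m p l L N) :
    Prop where
  hankel_u : stack (L + l) d.u = hankel (L + l) N M.ud *ᵥ d.α
  hankel_y : stack (L + l) d.y = hankel (L + l) N M.yd *ᵥ d.α
  init : window l d.u d.y 0 = ξ
  terminal : window l d.u d.y L ∈ M.Xf
  input : ∀ k < L, d.u (l + k) ∈ M.U
  output : ∀ k < L, d.y (l + k) ∈ M.Y

def cost (M : MPC m p l L N) (d : Decision m p l L N) : ℝ :=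
  (∑ k ∈ Finset.range L, (wsq M.R (d.u (l + k) - M.us) + wsq M.Q (d.y (l + k) - M.ys)))
    + wsq M.P (window l d.u d.y L - M.xis)

/-- The problem with initial condition `ξ` is feasible. -/
def Feasible (M : MPC m p l L N) (ξ : ExtIdx l m p → ℝ) : Prop := ∃ d, M.IsFeasible ξ d

/-- `d` is an optimal solution for the initial condition `ξ`. -/
def IsOptimal (M : MPC m p l L N) (ξ : ExtIdx l m p → ℝ) (d : Decision m p l L N) : Prop :=
  M.IsFeasible ξ d ∧ ∀ d', M.IsFeasible ξ d' → M.cost d ≤ M.cost d'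

/-- The optimal cost (used only where the problem is feasible; all costs are nonnegative when
the weights are positive definite). -/
noncomputable def value (M : MPC m p l L N) (ξ : ExtIdx l m p → ℝ) : ℝ :=
  sInf (M.cost '' {d | M.IsFeasible ξ d})

/-- The terminal ingredients `P`, `K`, `Xf`. -/
structure TerminalIngredients (M : MPC m p l L N) (E : ARX m p)
    (K : Matrix (Fin m) (ExtIdx l m p) ℝ) : Prop where
  posDef : M.P.PosDef
  subset : ∀ ξ ∈ M.Xf, (∀ i, (fun a => ξ (Sum.inl (i, a))) ∈ M.U) ∧
    ∀ i, (fun a => ξ (Sum.inr (i, a))) ∈ M.Y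
  setpoint : M.xis ∈ interior M.Xf
  invariant : ∀ ξ ∈ M.Xf, E.At l *ᵥ ξ + E.Bt l *ᵥ (M.us + K *ᵥ (ξ - M.xis)) ∈ M.Xf
  input : ∀ ξ ∈ M.Xf, M.us + K *ᵥ (ξ - M.xis) ∈ M.U
  output : ∀ ξ ∈ M.Xf, E.Ct l *ᵥ ξ + E.Dt *ᵥ (M.us + K *ᵥ (ξ - M.xis)) ∈ M.Y
  decrease : ∀ ξ ∈ M.Xf,
    wsq M.P ((E.At l + E.Bt l * K) *ᵥ (ξ - M.xis)) ≤
      wsq M.P (ξ - M.xis) - wsq (Kᵀ * M.R * K) (ξ - M.xis)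
        - wsq M.Q (E.Ct l *ᵥ ξ + E.Dt *ᵥ (M.us + K *ᵥ (ξ - M.xis)) - M.ys)

/-- The optimal value function is quadratically upper bounded where the problem is feasible. -/
def QuadUpperBound (M : MPC m p l L N) : Prop :=
  ∃ cu : ℝ, 0 < cu ∧ ∀ ξ, M.Feasible ξ → M.value ξ ≤ cu * norm2 (ξ - M.xis) ^ 2

/-- `x`, `u`, `y` is a closed-loop run. The entry with index `l + t` belongs to time `t ≥ -l`, so
that `window l u y t` is the extended state `ξ_t` made of the `l` measurements before time `t`.
The sequences obey the system from time `-l` on, the inputs before time `0` being arbitrary. At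
every time `t ≥ 0` at which the problem is feasible, the applied input is the first input of some
optimal solution (any one, if there are several). -/
structure ClosedLoop {n : ℕ} (M : MPC m p l L N) (S : LTI n m p) (x : ℕ → Fin n → ℝ)
    (u : ℕ → Fin m → ℝ) (y : ℕ → Fin p → ℝ) : Prop where
  plant : ∀ k, S.StepAt x u y k
  control : ∀ t, M.Feasible (window l u y t) →
    ∃ d, M.IsOptimal (window l u y t) d ∧ u (l + t) = d.u l

/-- The setpoint is exponentially stable for the closed loop, the region of attraction being the
set of all initial extended states for which the problem is feasible. This region contains all
extended states near the setpoint that the system can produce, and the constants `c`, `ρ` are the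
same for all closed-loop runs that start in it. -/
def ExponentiallyStable {n : ℕ} (M : MPC m p l L N) (S : LTI n m p) : Prop :=
  (∃ δ : ℝ, 0 < δ ∧ ∀ u y, S.IsTrajectory l u y →
    norm2 (window l u y 0 - M.xis) < δ → M.Feasible (window l u y 0)) ∧
  ∃ c ρ : ℝ, 0 < c ∧ 0 < ρ ∧ ρ < 1 ∧ ∀ x u y, M.ClosedLoop S x u y →
    M.Feasible (window l u y 0) →
    ∀ t : ℕ, norm2 (window l u y t - M.xis) ≤ c * ρ ^ t * norm2 (window l u y 0 - M.xis)

end MPC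

end DDMPC

/-! The data-driven problem is ordinary model predictive control in disguise. By
`isTrajectory_of_hankel` and Willems' fundamental lemma `LTI.IsTrajectory.exists_hankel`, the Hankel
constraints describe exactly the system trajectories of length `L + l`. The extended state then
evolves by its own equations along each of them.

Recursive feasibility and decrease of the value are the standard terminal-set argument: drop the
first step of an optimal prediction and append one step of the terminal controller. The terminal
inequality pays for the appended stage cost, so the cost falls by the dropped one
(`TerminalIngredients.exists_successor`). Plant and prediction agree over one step
(`ClosedLoop.step`).

The stage cost controls only the current input and output, not the whole extended state, so the
value function alone need not decrease strictly. Adding a small multiple of a sum of past squared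
deviations, with weights growing towards the newest, gives a strict Lyapunov function and hence a
uniform exponential rate (`exists_exponential_decay`). Local feasibility comes from running the
terminal controller for `L` steps inside the terminal set (`TerminalIngredients.feasible`). -/

namespace DDMPC

open Matrix

/-! ### Full row rank -/

section FullRowRank

variable {ι κ : Type*} [Fintype ι] [Fintype κ]

/-- A matrix of full row rank has trivial left kernel. -/
lemma eq_zero_of_vecMul_eq_zero {W : Matrix ι κ ℝ} (h : W.rank = Fintype.card ι) {w : ι → ℝ}
    (hw : w ᵥ* W = 0) : w = 0 := by
  have hli : LinearIndependent ℝ W.row := by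
    rw [linearIndependent_iff_card_eq_finrank_span, ← h, W.rank_eq_finrank_span_row]
    rfl
  exact Matrix.vecMul_injective_iff.2 hli (by simpa using hw)

/-- A matrix of full column rank has trivial kernel. -/
lemma eq_zero_of_mulVec_eq_zero {W : Matrix ι κ ℝ} (h : W.rank = Fintype.card κ) {w : κ → ℝ}
    (hw : W *ᵥ w = 0) : w = 0 := by
  refine eq_zero_of_vecMul_eq_zero (W := Wᵀ) (by rw [rank_transpose, h]) ?_
  rw [vecMul_transpose, hw]

/-- A matrix with trivial left kernel is onto. -/
lemma exists_mulVec_eq_of_vecMul {W : Matrix ι κ ℝ} (h : ∀ w, w ᵥ* W = 0 → w = 0)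
    (b : ι → ℝ) : ∃ a, W *ᵥ a = b := by
  have hli : LinearIndependent ℝ W.row := by
    rw [← Matrix.vecMul_injective_iff]
    intro w w' hww
    refine sub_eq_zero.1 (h _ ?_)
    rw [sub_vecMul, sub_eq_zero]
    exact hww
  have hr : LinearMap.range W.mulVecLin = ⊤ := by
    refine Submodule.eq_top_of_finrank_eq ?_
    rw [Module.finrank_fintype_fun_eq_card]
    exact hli.rank_matrix
  obtain ⟨a, ha⟩ := LinearMap.range_eq_top.1 hr b
  exact ⟨a, ha⟩

end FullRowRank

/-! ### Trajectories -/

variable {n m p l L N T : ℕ} {S : LTI n m p} {E : ARX m p}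
  {u : ℕ → Fin m → ℝ} {y : ℕ → Fin p → ℝ} {x : ℕ → Fin n → ℝ}

lemma LTI.IsTrajectory.mono {T' : ℕ} (h : S.IsTrajectory T u y) (hT : T' ≤ T) :
    S.IsTrajectory T' u y := by
  obtain ⟨x, hx⟩ := h
  exact ⟨x, fun k hk => hx k (hk.trans_le hT)⟩

lemma LTI.IsTrajectory.shift {t : ℕ} (h : S.IsTrajectory (t + T) u y) :
    S.IsTrajectory T (fun k => u (t + k)) (fun k => y (t + k)) := by
  obtain ⟨x, hx⟩ := h
  exact ⟨fun k => x (t + k), fun k hk => hx (t + k) (by omega)⟩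

/-- A trajectory can be continued by one step with any input. -/
lemma LTI.IsTrajectory.extend (h : S.IsTrajectory T u y) (v : Fin m → ℝ) :
    ∃ u' y', S.IsTrajectory (T + 1) u' y' ∧ (∀ k < T, u' k = u k ∧ y' k = y k) ∧ u' T = v := by
  obtain ⟨x, hx⟩ := h
  refine ⟨fun k => if k < T then u k else v,
    fun k => if k < T then y k else S.C *ᵥ x T + S.D *ᵥ v,
    ⟨fun k => if k ≤ T then x k else S.A *ᵥ x T + S.B *ᵥ v, fun k hk => ?_⟩,
    fun k hk => by simp [hk], by simp⟩
  rcases (Nat.lt_succ_iff_lt_or_eq.1 hk) with hk | rfl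
  · have := hx k hk
    simp only [LTI.StepAt] at this ⊢
    simp only [hk, hk.le, Nat.succ_le_of_lt hk, if_true]
    exact this
  · simp [LTI.StepAt]

/-- The state after `k` steps, tested against a row vector. -/
lemma dotProduct_state (h : ∀ k < N, S.StepAt x u y k) (r : Fin n → ℝ) (j k : ℕ)
    (hk : j + k ≤ N) :
    r ⬝ᵥ x (j + k) = (r ᵥ* S.A ^ k) ⬝ᵥ x j
      + ∑ s ∈ Finset.range k, (r ᵥ* (S.A ^ (k - 1 - s) * S.B)) ⬝ᵥ u (s + j) := by
  -- Undoing the last step moves one factor `S.A` onto the row vector, so `r` has to vary.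
  induction k generalizing r with
  | zero => simp
  | succ k ih =>
    have hs := (h (j + k) (by omega)).1
    rw [← add_assoc, hs, dotProduct_add, dotProduct_mulVec, dotProduct_mulVec,
      ih _ (by omega), Finset.sum_range_succ, vecMul_vecMul, ← pow_succ']
    have : ∀ s ∈ Finset.range k,
        ((r ᵥ* S.A) ᵥ* (S.A ^ (k - 1 - s) * S.B)) ⬝ᵥ u (s + j)
          = (r ᵥ* (S.A ^ (k + 1 - 1 - s) * S.B)) ⬝ᵥ u (s + j) := by
      intro s hs
      have hsk := Finset.mem_range.1 hs
      rw [vecMul_vecMul, ← Matrix.mul_assoc, ← pow_succ',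
        show k - 1 - s + 1 = k + 1 - 1 - s by omega]
    rw [Finset.sum_congr rfl this]
    simp [add_assoc, add_comm k j]

/-! ### Persistence of excitation and the fundamental lemma -/

/-- The form in which excitation is used: the relations over all `j` say, column by column, that the
stacked `g` annihilates the Hankel matrix from the left. -/
lemma PersistentlyExciting.eq_zero {q : ℕ} {v g : ℕ → Fin q → ℝ}
    (h : PersistentlyExciting T N v)
    (hg : ∀ j, j + T ≤ N → ∑ s ∈ Finset.range T, g s ⬝ᵥ v (s + j) = 0) :
    ∀ s < T, g s = 0 := by
  have hz : stack T g = 0 := by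
    refine eq_zero_of_vecMul_eq_zero (W := hankel T N v) ?_ ?_
    · rw [h]; simp [mul_comm]
    · ext j
      have := hg j (by have := j.2; omega)
      rw [← Fin.sum_univ_eq_sum_range (fun s => g s ⬝ᵥ v (s + j)) T] at this
      simp only [vecMul, dotProduct, Fintype.sum_prod_type, stack, hankel, of_apply,
        Pi.zero_apply] at this ⊢
      exact this
  intro s hs
  ext a
  exact congrFun hz (⟨s, hs⟩, a)

/-- For controllable systems, input windows and states of persistently exciting data have no
common left annihilator. -/
lemma annihilator_eq_zero (hctrb : S.Controllable) (hx : ∀ k < N, S.StepAt x u y k)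
    (hpe : PersistentlyExciting (T + n) N u) {r : Fin n → ℝ} {g : ℕ → Fin m → ℝ}
    (hg : ∀ s, T ≤ s → g s = 0)
    (hrg : ∀ j, j + T ≤ N → r ⬝ᵥ x j + ∑ s ∈ Finset.range T, g s ⬝ᵥ u (s + j) = 0) :
    r = 0 ∧ ∀ s, g s = 0 := by
  -- Cayley–Hamilton will eliminate the state: the annihilating relation, taken at times `j, …, j +
  -- n` and rewritten in terms of `x j`, has state rows `r A^k`, whose combination with the
  -- coefficients `a k` vanishes.
  let a : ℕ → ℝ := fun k => S.A.charpoly.coeff k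
  have han : a n = 1 := by
    have h1 := S.A.charpoly_monic
    have h2 := S.A.charpoly_natDegree_eq_dim
    rw [Fintype.card_fin] at h2
    rw [Polynomial.Monic, Polynomial.leadingCoeff, h2] at h1
    exact h1
  have hCH : ∑ k ∈ Finset.range (n + 1), a k • S.A ^ k = 0 := by
    have h1 := S.A.aeval_self_charpoly
    rw [Polynomial.aeval_eq_sum_range, S.A.charpoly_natDegree_eq_dim, Fintype.card_fin] at h1
    exact h1
  -- One sequence holds all input coefficients: the relation at time `j + k`, rewritten from `x j`,
  -- has coefficients `h` shifted by `n - k`. The first `n` entries carry the controllability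
  -- blocks, the later ones `g`.
  let h : ℕ → Fin m → ℝ := fun i =>
    if i < n then r ᵥ* (S.A ^ (n - 1 - i) * S.B) else g (i - n)
  have hshift : ∀ k ≤ n, ∀ j, j + (T + n) ≤ N →
      (r ᵥ* S.A ^ k) ⬝ᵥ x j
        + ∑ s ∈ Finset.range (T + n), h (s + (n - k)) ⬝ᵥ u (s + j) = 0 := by
    intro k hk j hj
    have h0 := hrg (j + k) (by omega)
    rw [dotProduct_state hx r j k (by omega), add_assoc] at h0
    rw [← h0, show T + n = k + (T + (n - k)) by omega, Finset.sum_range_add,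
      Finset.sum_range_add (fun s => h (k + s + (n - k)) ⬝ᵥ u (k + s + j))]
    have h1 : ∀ s ∈ Finset.range k, h (s + (n - k)) ⬝ᵥ u (s + j)
        = (r ᵥ* (S.A ^ (k - 1 - s) * S.B)) ⬝ᵥ u (s + j) := by
      intro s hs
      have := Finset.mem_range.1 hs
      simp only [h]
      rw [if_pos (by omega), show n - 1 - (s + (n - k)) = k - 1 - s by omega]
    have h2 : ∀ s, h (k + s + (n - k)) = g s := by
      intro s
      simp only [h]
      rw [if_neg (by omega), show k + s + (n - k) - n = s by omega]
    have h3 : ∑ s ∈ Finset.range (n - k), g (T + s) ⬝ᵥ u (k + (T + s) + j) = 0 :=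
      Finset.sum_eq_zero fun s _ => by rw [hg _ (by omega), zero_dotProduct]
    rw [Finset.sum_congr rfl h1]
    simp only [h2]
    rw [h3, add_zero]
    simp only [show ∀ s, k + s + j = s + (j + k) by intro s; omega]
  -- Once the state part cancels, a relation in inputs alone remains, over a window of length `T +
  -- n`; this is where the extra order `n` of excitation is spent.
  have hrec : ∀ s < T + n, ∑ k ∈ Finset.range (n + 1), a k • h (s + (n - k)) = 0 := by
    refine hpe.eq_zero fun j hj => ?_
    have h1 : ∑ k ∈ Finset.range (n + 1), a k * ((r ᵥ* S.A ^ k) ⬝ᵥ x j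
        + ∑ s ∈ Finset.range (T + n), h (s + (n - k)) ⬝ᵥ u (s + j)) = 0 :=
      Finset.sum_eq_zero fun k hk => by
        rw [hshift k (by have := Finset.mem_range.1 hk; omega) j hj, mul_zero]
    have h2 : ∑ k ∈ Finset.range (n + 1), a k * ((r ᵥ* S.A ^ k) ⬝ᵥ x j) = 0 := by
      have : (r ᵥ* ∑ k ∈ Finset.range (n + 1), a k • S.A ^ k) ⬝ᵥ x j = 0 := by
        rw [hCH, vecMul_zero, zero_dotProduct]
      rw [vecMul_sum, sum_dotProduct] at this
      simpa [vecMul_smul] using this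
    simp only [mul_add, Finset.sum_add_distrib, h2, zero_add, Finset.mul_sum] at h1
    rw [Finset.sum_comm] at h1
    simpa [sum_dotProduct] using h1
  -- Backward induction: in `hrec` the term `k = n` is `h s` with leading coefficient `1`, and all
  -- other terms involve later entries of `h`, which vanish from `T + n` on.
  have hzero : ∀ d s, T + n ≤ s + d → h s = 0 := by
    intro d
    induction d with
    | zero =>
      intro s hs
      simp only [h]
      rw [if_neg (by omega), hg _ (by omega)]
    | succ d ih =>
      intro s hs
      by_cases hs' : T + n ≤ s + d
      · exact ih s hs'
      by_cases hsT : s < T + n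
      · have h2 := hrec s hsT
        rw [Finset.sum_range_succ, Finset.sum_eq_zero, han] at h2
        · simpa using h2
        · intro k hk
          have := Finset.mem_range.1 hk
          rw [ih _ (by omega), smul_zero]
      · exact ih s (by omega)
  refine ⟨?_, fun s => ?_⟩
  · refine eq_zero_of_vecMul_eq_zero (W := S.ctrbMatrix) (by rw [hctrb]; simp) ?_
    ext ⟨k, b⟩
    have h1 := hzero (T + n) (n - 1 - k) (by omega)
    have hk := k.2
    simp only [h] at h1
    rw [if_pos (by omega), show n - 1 - (n - 1 - (k : ℕ)) = k by omega] at h1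
    exact congrFun h1 b
  · have h1 := hzero (T + n) (n + s) (by omega)
    simpa [h] using h1

/-- The state sequence generated by a combination of data columns. -/
lemma stepAt_combination {ud : ℕ → Fin m → ℝ} {yd : ℕ → Fin p → ℝ} {xd : ℕ → Fin n → ℝ}
    (hx : ∀ k < N, S.StepAt xd ud yd k) (α : Fin (N + 1 - T) → ℝ) {k : ℕ} (hk : k < T) :
    S.StepAt (fun k => ∑ j, α j • xd (k + j)) (fun k => ∑ j, α j • ud (k + j))
      (fun k => ∑ j, α j • yd (k + j)) k := by
  have h : ∀ j : Fin (N + 1 - T), S.StepAt xd ud yd (k + j) := fun j =>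
    hx _ (by have := j.2; omega)
  constructor
  · simp only [mulVec_sum, mulVec_smul, ← Finset.sum_add_distrib, ← smul_add]
    refine Finset.sum_congr rfl fun j _ => ?_
    rw [← (h j).1, add_right_comm]
  · simp only [mulVec_sum, mulVec_smul, ← Finset.sum_add_distrib, ← smul_add]
    exact Finset.sum_congr rfl fun j _ => by rw [← (h j).2]

lemma stack_eq_hankel_mulVec_iff {q : ℕ} {v vd : ℕ → Fin q → ℝ} {α : Fin (N + 1 - T) → ℝ} :
    stack T v = hankel T N vd *ᵥ α ↔ ∀ k < T, v k = ∑ j, α j • vd (k + j) := by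
  constructor
  · intro h k hk
    ext a
    have := congrFun h (⟨k, hk⟩, a)
    simpa [stack, hankel, mulVec, dotProduct, mul_comm] using this
  · intro h
    ext ⟨k, a⟩
    have := congrFun (h k k.2) a
    simpa [stack, hankel, mulVec, dotProduct, mul_comm] using this

/-- Combinations of data windows are trajectories. -/
lemma isTrajectory_of_hankel {ud : ℕ → Fin m → ℝ} {yd : ℕ → Fin p → ℝ}
    (hdata : S.IsTrajectory N ud yd) {α : Fin (N + 1 - T) → ℝ}
    (hu : stack T u = hankel T N ud *ᵥ α) (hy : stack T y = hankel T N yd *ᵥ α) :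
    S.IsTrajectory T u y := by
  obtain ⟨xd, hx⟩ := hdata
  rw [stack_eq_hankel_mulVec_iff] at hu hy
  refine ⟨fun k => ∑ j, α j • xd (k + j), fun k hk => ?_⟩
  have := stepAt_combination hx α hk
  simp only [LTI.StepAt] at this ⊢
  rwa [hu k hk, hy k hk]

/-- **Willems' fundamental lemma**: every trajectory is a combination of windows of
persistently exciting data. -/
lemma LTI.IsTrajectory.exists_hankel {ud : ℕ → Fin m → ℝ} {yd : ℕ → Fin p → ℝ}
    (h : S.IsTrajectory T u y) (hctrb : S.Controllable) (hdata : S.IsTrajectory N ud yd)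
    (hpe : PersistentlyExciting (T + n) N ud) :
    ∃ α : Fin (N + 1 - T) → ℝ,
      stack T u = hankel T N ud *ᵥ α ∧ stack T y = hankel T N yd *ᵥ α := by
  obtain ⟨xd, hxd⟩ := hdata
  obtain ⟨x, hx⟩ := h
  let X : Matrix (Fin n) (Fin (N + 1 - T)) ℝ := Matrix.of fun i j => xd j i
  -- A single `α` matches the input window and the initial state at once; states and outputs then
  -- agree because both sides obey the same recursion. Solvability is the absence of a common left
  -- annihilator.
  obtain ⟨α, hα⟩ : ∃ α, fromRows (hankel T N ud) X *ᵥ α = Sum.elim (stack T u) (x 0) := by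
    refine exists_mulVec_eq_of_vecMul (fun w hw => ?_) _
    let g : ℕ → Fin m → ℝ := fun s b => if hs : s < T then w (Sum.inl (⟨s, hs⟩, b)) else 0
    obtain ⟨hr, hg⟩ := annihilator_eq_zero (T := T) (r := fun i => w (Sum.inr i)) (g := g)
      hctrb hxd hpe (fun s hs => by ext b; simp [g, not_lt.2 hs]) (fun j hj => by
        have h1 := congrFun hw ⟨j, by omega⟩
        rw [← Fin.sum_univ_eq_sum_range (fun s => g s ⬝ᵥ ud (s + j)) T, add_comm]
        simpa [vecMul, dotProduct, Fintype.sum_sum_type, Fintype.sum_prod_type, hankel, X, g]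
          using h1)
    ext (⟨s, b⟩ | i)
    · simpa [g] using congrFun (hg s) b
    · exact congrFun hr i
  rw [fromRows_mulVec] at hα
  have hu : stack T u = hankel T N ud *ᵥ α := by
    ext i; exact (congrFun hα (Sum.inl i)).symm
  have hx0 : x 0 = ∑ j, α j • xd j := by
    ext i
    have := (congrFun hα (Sum.inr i)).symm
    simpa [X, mulVec, dotProduct, mul_comm] using this
  refine ⟨α, hu, ?_⟩
  rw [stack_eq_hankel_mulVec_iff] at hu ⊢
  have hstate : ∀ k ≤ T, x k = ∑ j, α j • xd (k + j) := by
    intro k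
    induction k with
    | zero => intro _; simpa using hx0
    | succ k ih =>
      intro hk
      rw [(hx k hk).1, ih (by omega), hu k hk]
      exact (stepAt_combination hxd α hk).1.symm
  intro k hk
  rw [(hx k hk).2, hstate k hk.le, hu k hk]
  exact (stepAt_combination hxd α hk).2.symm

/-! ### Windows and the extended state -/

lemma window_congr {u' : ℕ → Fin m → ℝ} {y' : ℕ → Fin p → ℝ} {t t' : ℕ}
    (h : ∀ i < l, u (t + i) = u' (t' + i) ∧ y (t + i) = y' (t' + i)) :
    window l u y t = window l u' y' t' := by
  ext (⟨i, a⟩ | ⟨i, a⟩)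
  · exact congrFun (h i i.2).1 a
  · exact congrFun (h i i.2).2 a

lemma window_shift (t s : ℕ) :
    window l (fun k => u (t + k)) (fun k => y (t + k)) s = window l u y (t + s) :=
  window_congr fun i _ => by simp only [add_assoc, and_self]

/-- The extended-state equations at time `t` of a trajectory. -/
lemma ARX.Describes.window_succ (hE : E.Describes l S) {t : ℕ}
    (h : S.IsTrajectory (t + (l + 1)) u y) :
    window l u y (t + 1) = E.At l *ᵥ window l u y t + E.Bt l *ᵥ u (l + t) ∧
    y (l + t) = E.Ct l *ᵥ window l u y t + E.Dt *ᵥ u (l + t) := by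
  have := hE.2 _ _ h.shift
  rwa [window_shift, window_shift, add_zero, add_comm t l] at this

/-- Continuation of a trajectory by one step, in terms of the extended state. -/
lemma ARX.Describes.extend (hE : E.Describes l S) (h : S.IsTrajectory (T + l) u y)
    (v : Fin m → ℝ) :
    ∃ u' y', S.IsTrajectory (T + 1 + l) u' y' ∧
      (∀ k < T + l, u' k = u k ∧ y' k = y k) ∧ u' (l + T) = v ∧
      y' (l + T) = E.Ct l *ᵥ window l u y T + E.Dt *ᵥ v ∧
      window l u' y' (T + 1) = E.At l *ᵥ window l u y T + E.Bt l *ᵥ v := by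
  obtain ⟨u', y', htr, hag, huv⟩ := h.extend v
  rw [add_comm T l] at huv
  have hw : window l u' y' T = window l u y T := window_congr fun i hi => hag _ (by omega)
  obtain ⟨h1, h2⟩ := hE.window_succ (t := T) (htr.mono (by omega))
  rw [hw, huv] at h1 h2
  exact ⟨u', y', htr.mono (by omega), hag, huv, h2, h1⟩

/-- By observability, an equilibrium is a constant trajectory of arbitrary length. -/
lemma LTI.IsEquilibrium.isTrajectory {l₀ : ℕ} {us : Fin m → ℝ} {ys : Fin p → ℝ}
    (h : S.IsEquilibrium l₀ us ys) (hlag : S.IsLag l₀) (T : ℕ) :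
    S.IsTrajectory T (fun _ => us) (fun _ => ys) := by
  obtain ⟨x, hx⟩ := h
  have hl₀ := hlag.1.1
  -- With constant input, state increments evolve autonomously by `S.A`. Constant output puts `x 0 -
  -- x 1` in the kernel of the observability matrix; the `l₀` output differences need the `l₀ + 1`
  -- samples.
  have hdiff : ∀ k ≤ l₀, x k - x (k + 1) = S.A ^ k *ᵥ (x 0 - x 1) := by
    intro k
    induction k with
    | zero => simp
    | succ k ih =>
      intro hk
      have h1 := (hx k (by omega)).1
      have h2 := (hx (k + 1) (by omega)).1
      rw [pow_succ', ← mulVec_mulVec, ← ih (by omega), mulVec_sub, h2]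
      nth_rewrite 1 [h1]
      abel
  have hz : x 0 - x 1 = 0 := by
    refine eq_zero_of_mulVec_eq_zero (W := S.obsvMatrix l₀) (by rw [hlag.1.2.2]; simp) ?_
    ext ⟨k, a⟩
    have hk := k.2
    have h1 := (hx k (by omega)).2
    have h2 := (hx (k + 1) (by omega)).2
    have h3 : S.C *ᵥ (x k - x (k + 1)) = 0 := by
      rw [mulVec_sub, sub_eq_zero]
      exact add_right_cancel (h1.symm.trans h2)
    rw [hdiff k hk.le, mulVec_mulVec] at h3
    exact congrFun h3 a
  have h0 := hx 0 (by omega)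
  refine ⟨fun _ => x 0, fun k _ => ⟨?_, h0.2⟩⟩
  exact (sub_eq_zero.1 hz).trans h0.1

/-! ### Quadratic forms and norms -/

section Quadratic

variable {ι : Type*} [Fintype ι]

lemma norm2_sq (z : ι → ℝ) : norm2 z ^ 2 = ∑ i, z i ^ 2 := by
  rw [norm2, EuclideanSpace.real_norm_sq_eq]

lemma norm2_nonneg (z : ι → ℝ) : 0 ≤ norm2 z := norm_nonneg _

lemma wsq_nonneg {P : Matrix ι ι ℝ} (hP : P.PosDef) (z : ι → ℝ) : 0 ≤ wsq P z := by
  have := hP.posSemidef.dotProduct_mulVec_nonneg z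
  simpa [wsq] using this

lemma wsq_transpose_mul_mul {κ : Type*} [Fintype κ] (R : Matrix κ κ ℝ) (K : Matrix κ ι ℝ)
    (z : ι → ℝ) : wsq (Kᵀ * R * K) z = wsq R (K *ᵥ z) := by
  rw [wsq, wsq, ← mulVec_mulVec, ← mulVec_mulVec, dotProduct_mulVec, vecMul_transpose]

/-- A positive definite form dominates a multiple of the squared norm. -/
lemma exists_mul_norm2_sq_le_wsq {P : Matrix ι ι ℝ} (hP : P.PosDef) :
    ∃ c : ℝ, 0 < c ∧ ∀ z, c * norm2 z ^ 2 ≤ wsq P z := by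
  let f : EuclideanSpace ℝ ι → ℝ := fun z => wsq P (WithLp.ofLp z)
  have hf : Continuous f := by
    simp only [f, wsq, dotProduct, mulVec]
    fun_prop
  -- The constant is the minimum of the form over the unit sphere. The sphere is empty only in
  -- dimension zero, where any constant works.
  rcases (Metric.sphere (0 : EuclideanSpace ℝ ι) 1).eq_empty_or_nonempty with he | hne
  · refine ⟨1, one_pos, fun z => ?_⟩
    have hz : WithLp.toLp 2 z = 0 := by
      by_contra hz
      have : (‖WithLp.toLp 2 z‖⁻¹ • WithLp.toLp 2 z) ∈
          Metric.sphere (0 : EuclideanSpace ℝ ι) 1 := by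
        simp [norm_smul, hz]
      rw [he] at this
      exact this
    simpa [norm2, hz] using wsq_nonneg hP z
  · obtain ⟨z₀, hz₀, hmin⟩ := (isCompact_sphere (0 : EuclideanSpace ℝ ι) 1).exists_isMinOn hne
      hf.continuousOn
    refine ⟨f z₀, ?_, fun z => ?_⟩
    · have hne0 : WithLp.ofLp z₀ ≠ 0 := by
        intro h
        have : z₀ = 0 := by ext i; exact congrFun h i
        simp [this] at hz₀
      simpa [f, wsq] using hP.dotProduct_mulVec_pos hne0
    · by_cases hz : WithLp.toLp 2 z = 0
      · simpa [norm2, hz] using wsq_nonneg hP z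
      · have hpos : 0 < norm2 z := norm_pos_iff.2 hz
        have hmem : ((norm2 z)⁻¹ • WithLp.toLp 2 z) ∈
            Metric.sphere (0 : EuclideanSpace ℝ ι) 1 := by
          simp [norm_smul, norm2, hz]
        have h1 : f z₀ ≤ f ((norm2 z)⁻¹ • WithLp.toLp 2 z) := hmin hmem
        have h2 : f ((norm2 z)⁻¹ • WithLp.toLp 2 z) = (norm2 z)⁻¹ ^ 2 * wsq P z := by
          simp only [f, wsq, WithLp.ofLp_smul, mulVec_smul, smul_dotProduct, dotProduct_smul,
            smul_eq_mul]
          ring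
        rw [h2] at h1
        calc f z₀ * norm2 z ^ 2 ≤ (norm2 z)⁻¹ ^ 2 * wsq P z * norm2 z ^ 2 := by gcongr
          _ = wsq P z := by field_simp

/-- Interior points have a Euclidean neighborhood inside the set. -/
lemma exists_norm2_lt_mem {s : Set (ι → ℝ)} {z₀ : ι → ℝ} (h : z₀ ∈ interior s) :
    ∃ δ : ℝ, 0 < δ ∧ ∀ z, norm2 (z - z₀) < δ → z ∈ s := by
  obtain ⟨δ, hδ, hball⟩ := Metric.mem_nhds_iff.1 (mem_interior_iff_mem_nhds.1 h)
  refine ⟨δ, hδ, fun z hz => hball ?_⟩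
  -- The ambient metric on functions is the sup metric, which the Euclidean norm dominates.
  rw [Metric.mem_ball, dist_eq_norm, pi_norm_lt_iff hδ]
  intro i
  exact (PiLp.norm_apply_le (WithLp.toLp 2 (z - z₀)) i).trans_lt hz

end Quadratic

/-- The squared distance of an extended state to the setpoint, block by block. -/
lemma norm2_window_sub_constExt_sq (us : Fin m → ℝ) (ys : Fin p → ℝ) (t : ℕ) :
    norm2 (window l u y t - constExt l us ys) ^ 2 =
      ∑ i ∈ Finset.range l, (norm2 (u (t + i) - us) ^ 2 + norm2 (y (t + i) - ys) ^ 2) := by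
  rw [← Fin.sum_univ_eq_sum_range
    (fun i => norm2 (u (t + i) - us) ^ 2 + norm2 (y (t + i) - ys) ^ 2) l]
  simp only [norm2_sq, Fintype.sum_sum_type, Fintype.sum_prod_type, Finset.sum_add_distrib,
    Pi.sub_apply, window, constExt, Sum.elim_inl, Sum.elim_inr]

/-! ### Exponential decay from a semidefinite decrease -/

/-- Advancing the window lowers the weight of every old entry by one, which costs one plain window
sum, and the new entry comes in with weight `l`. -/
lemma sum_weighted_window_succ (w : ℕ → ℝ) (l t : ℕ) :
    ∑ i ∈ Finset.range l, ((i : ℝ) + 1) * w (t + 1 + i) =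
      ∑ i ∈ Finset.range l, ((i : ℝ) + 1) * w (t + i) - ∑ i ∈ Finset.range l, w (t + i)
        + l * w (l + t) := by
  induction l with
  | zero => simp
  | succ l ih =>
    simp only [Finset.sum_range_succ, ih]
    rw [add_comm t l, show t + 1 + l = l + 1 + t by omega]
    push_cast
    ring

/-- If `V` is bounded by a multiple of the window sums of `w ≥ 0` and decreases along `w`, then
the window sums decay exponentially, uniformly in `V` and `w`. -/
lemma exists_exponential_decay {l : ℕ} (hl : 1 ≤ l) {c cu : ℝ} (hc : 0 < c) (hcu : 0 < cu) :
    ∃ C q : ℝ, 0 < C ∧ 0 < q ∧ q < 1 ∧ ∀ w V : ℕ → ℝ, (∀ k, 0 ≤ w k) → (∀ t, 0 ≤ V t) →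
      (∀ t, V t ≤ cu * ∑ i ∈ Finset.range l, w (t + i)) →
      (∀ t, V (t + 1) ≤ V t - c * w (l + t)) →
      ∀ t, ∑ i ∈ Finset.range l, w (t + i) ≤ C * q ^ t * ∑ i ∈ Finset.range l, w (0 + i) := by
  have hl' : (1 : ℝ) ≤ l := by exact_mod_cast hl
  -- With this `ε`, the entering term `ε * l * w (l + t)` is exactly what the decrease `c * w (l +
  -- t)` of `V` compensates.
  obtain ⟨ε, hε⟩ : ∃ ε, ε = c / l := ⟨_, rfl⟩
  have hεl : ε * l = c := by rw [hε]; field_simp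
  have hε0 : 0 < ε := by rw [hε]; positivity
  have hεc : ε ≤ c := by nlinarith
  refine ⟨(cu + c) / ε, 1 - ε / (cu + c), by positivity, ?_, ?_, fun w V hw hV hVu hVd t => ?_⟩
  · rw [sub_pos, div_lt_one (by positivity)]; linarith
  · have : 0 < ε / (cu + c) := by positivity
    linarith
  let X : ℕ → ℝ := fun t => ∑ i ∈ Finset.range l, w (t + i)
  -- The strict Lyapunov function: `ε X ≤ W ≤ (cu + c) X` and `W` drops by at least `ε X` per step.
  -- This yields the rate `1 - ε / (cu + c)` and the factor `(cu + c) / ε`.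
  let W : ℕ → ℝ := fun t => V t + ε * ∑ i ∈ Finset.range l, ((i : ℝ) + 1) * w (t + i)
  have hXU : ∀ t, X t ≤ ∑ i ∈ Finset.range l, ((i : ℝ) + 1) * w (t + i) := fun t =>
    Finset.sum_le_sum fun i _ => le_mul_of_one_le_left (hw _) (by simp)
  have hUX : ∀ t, ∑ i ∈ Finset.range l, ((i : ℝ) + 1) * w (t + i) ≤ l * X t := by
    intro t
    rw [Finset.mul_sum]
    refine Finset.sum_le_sum fun i hi => mul_le_mul_of_nonneg_right ?_ (hw _)
    exact_mod_cast Finset.mem_range.1 hi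
  have hWX : ∀ t, W t ≤ (cu + c) * X t := by
    intro t
    have h1 : V t ≤ cu * X t := hVu t
    have h2 := mul_le_mul_of_nonneg_left (hUX t) hε0.le
    rw [← mul_assoc, hεl] at h2
    simp only [W]
    linarith
  have hXW : ∀ t, ε * X t ≤ W t := by
    intro t
    have h2 := mul_le_mul_of_nonneg_left (hXU t) hε0.le
    have := hV t
    simp only [W]
    linarith
  have hWd : ∀ t, W (t + 1) ≤ (1 - ε / (cu + c)) * W t := by
    intro t
    have h1 : W (t + 1) ≤ W t - ε * X t := by
      have h2 := hVd t
      simp only [W, X, sum_weighted_window_succ]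
      have h3 : ε * (l * w (l + t)) = c * w (l + t) := by rw [← mul_assoc, hεl]
      linarith
    have h4 : ε / (cu + c) * W t ≤ ε * X t := by
      have := mul_le_mul_of_nonneg_left (hWX t) (show 0 ≤ ε / (cu + c) by positivity)
      calc _ ≤ _ := this
        _ = ε * X t := by field_simp
    linarith
  have hq : 0 ≤ 1 - ε / (cu + c) := by
    rw [sub_nonneg, div_le_one (by positivity)]; linarith
  have hWt : W t ≤ (1 - ε / (cu + c)) ^ t * W 0 := by
    induction t with
    | zero => simp
    | succ t ih =>
      calc W (t + 1) ≤ (1 - ε / (cu + c)) * W t := hWd t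
        _ ≤ (1 - ε / (cu + c)) * ((1 - ε / (cu + c)) ^ t * W 0) := by gcongr
        _ = _ := by ring
  change X t ≤ (cu + c) / ε * (1 - ε / (cu + c)) ^ t * X 0
  have h5 : ε * X t ≤ (1 - ε / (cu + c)) ^ t * ((cu + c) * X 0) :=
    (hXW t).trans (hWt.trans (mul_le_mul_of_nonneg_left (hWX 0) (pow_nonneg hq t)))
  calc X t = ε * X t / ε := by field_simp
    _ ≤ (1 - ε / (cu + c)) ^ t * ((cu + c) * X 0) / ε := by gcongr
    _ = _ := by ring

/-! ### The closed loop -/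

namespace MPC

variable {M : MPC m p l L N} {K : Matrix (Fin m) (ExtIdx l m p) ℝ}
  {ξ : ExtIdx l m p → ℝ} {d : Decision m p l L N}

lemma cost_nonneg (hQ : M.Q.PosDef) (hR : M.R.PosDef) (hP : M.P.PosDef)
    (d : Decision m p l L N) : 0 ≤ M.cost d :=
  add_nonneg (Finset.sum_nonneg fun _ _ => add_nonneg (wsq_nonneg hR _) (wsq_nonneg hQ _))
    (wsq_nonneg hP _)

lemma IsOptimal.value_eq (h : M.IsOptimal ξ d) : M.value ξ = M.cost d := by
  refine IsLeast.csInf_eq ⟨⟨d, h.1, rfl⟩, ?_⟩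
  rintro _ ⟨d', hd', rfl⟩
  exact h.2 d' hd'

lemma IsFeasible.isTrajectory (h : M.IsFeasible ξ d) (hdata : S.IsTrajectory N M.ud M.yd) :
    S.IsTrajectory (L + l) d.u d.y :=
  isTrajectory_of_hankel hdata h.hankel_u h.hankel_y

/-- The setpoint is a fixed point of the extended-state dynamics. -/
lemma xis_eq {l₀ : ℕ} (hE : E.Describes l S) (hlag : S.IsLag l₀)
    (heq : S.IsEquilibrium l₀ M.us M.ys) :
    M.xis = E.At l *ᵥ M.xis + E.Bt l *ᵥ M.us := by
  have h := (hE.window_succ (t := 0) (heq.isTrajectory hlag (0 + (l + 1)))).1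
  exact h

/-- Every trajectory of length `l` ending in the terminal set is a feasible initial condition. -/
lemma TerminalIngredients.feasible (hterm : M.TerminalIngredients E K)
    (hctrb : S.Controllable) (hE : E.Describes l S) (hdata : S.IsTrajectory N M.ud M.yd)
    (hpe : PersistentlyExciting (L + l + n) N M.ud) (h : S.IsTrajectory l u y)
    (hmem : window l u y 0 ∈ M.Xf) : M.Feasible (window l u y 0) := by
  -- Run the terminal controller for `j` steps: invariance keeps the window in the terminal set,
  -- where the constraints hold. The case `j = L` is a candidate once the fundamental lemma supplies
  -- `α`.
  have key : ∀ j, ∃ u' y', S.IsTrajectory (j + l) u' y' ∧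
      window l u' y' 0 = window l u y 0 ∧ window l u' y' j ∈ M.Xf ∧
      ∀ k < j, u' (l + k) ∈ M.U ∧ y' (l + k) ∈ M.Y := by
    intro j
    induction j with
    | zero => exact ⟨u, y, by simpa using h, rfl, hmem, by simp⟩
    | succ j ih =>
      obtain ⟨u₁, y₁, htr, hw, hf, hc⟩ := ih
      obtain ⟨u', y', htr', hag, hu', hy', hw'⟩ :=
        hE.extend htr (M.us + K *ᵥ (window l u₁ y₁ j - M.xis))
      refine ⟨u', y', htr', ?_, ?_, fun k hk => ?_⟩
      · rw [← hw]
        exact window_congr fun i hi => hag _ (by omega)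
      · rw [hw']; exact hterm.invariant _ hf
      · rcases Nat.lt_succ_iff_lt_or_eq.1 hk with hk | rfl
        · rw [(hag (l + k) (by omega)).1, (hag (l + k) (by omega)).2]
          exact hc k hk
        · rw [hu', hy']
          exact ⟨hterm.input _ hf, hterm.output _ hf⟩
  obtain ⟨u', y', htr, hw, hf, hc⟩ := key L
  obtain ⟨α, hu, hy⟩ := htr.exists_hankel hctrb hdata hpe
  exact ⟨⟨α, u', y'⟩, hu, hy, hw, hf, fun k hk => (hc k hk).1, fun k hk => (hc k hk).2⟩

/-- The shifted candidate solution: its cost is smaller by at least the first stage cost. -/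
lemma TerminalIngredients.exists_successor {l₀ : ℕ} (hterm : M.TerminalIngredients E K)
    (hctrb : S.Controllable) (hlag : S.IsLag l₀) (hL : 1 ≤ L) (hE : E.Describes l S)
    (hdata : S.IsTrajectory N M.ud M.yd) (heq : S.IsEquilibrium l₀ M.us M.ys)
    (hpe : PersistentlyExciting (L + l + n) N M.ud) (hd : M.IsFeasible ξ d) :
    ∃ d', M.IsFeasible (window l d.u d.y 1) d' ∧
      M.cost d' ≤ M.cost d - (wsq M.R (d.u l - M.us) + wsq M.Q (d.y l - M.ys)) := by
  have hf := hd.terminal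
  obtain ⟨z, hz⟩ : ∃ z, z = window l d.u d.y L := ⟨_, rfl⟩
  obtain ⟨u', y', htr, hag, hu', hy', hw'⟩ :=
    hE.extend (hd.isTrajectory hdata) (M.us + K *ᵥ (window l d.u d.y L - M.xis))
  rw [← hz] at hf hu' hy' hw'
  have htr1 : S.IsTrajectory (L + l) (fun k => u' (1 + k)) (fun k => y' (1 + k)) :=
    LTI.IsTrajectory.shift (htr.mono (by omega))
  obtain ⟨α, hα⟩ := htr1.exists_hankel hctrb hdata hpe
  have hmem : ∀ k < L, u' (1 + (l + k)) ∈ M.U ∧ y' (1 + (l + k)) ∈ M.Y := by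
    intro k hk
    rcases lt_or_eq_of_le (Nat.succ_le_of_lt hk) with hk1 | hk1
    · rw [(hag (1 + (l + k)) (by omega)).1, (hag (1 + (l + k)) (by omega)).2,
        show 1 + (l + k) = l + (k + 1) by omega]
      exact ⟨hd.input _ hk1, hd.output _ hk1⟩
    · rw [show 1 + (l + k) = l + L by omega, hu', hy']
      exact ⟨hterm.input _ hf, hterm.output _ hf⟩
  refine ⟨⟨α, fun k => u' (1 + k), fun k => y' (1 + k)⟩,
    ⟨hα.1, hα.2, ?_, ?_, fun k hk => (hmem k hk).1, fun k hk => (hmem k hk).2⟩, ?_⟩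
  · rw [window_shift]
    exact window_congr fun i hi => hag _ (by omega)
  · rw [window_shift, add_comm 1 L, hw']
    exact hterm.invariant _ hf
  -- Stage costs along the extended prediction: the old cost sums `f 0, …, f (L - 1)`, the
  -- candidate's `f 1, …, f L`. The terminal decrease absorbs `f L`, leaving a gain of `f 0`.
  · let f : ℕ → ℝ := fun k =>
      wsq M.R (u' (l + k) - M.us) + wsq M.Q (y' (l + k) - M.ys)
    have hsum : ∑ k ∈ Finset.range L, f (k + 1) + f 0 = ∑ k ∈ Finset.range L, f k + f L := by
      rw [← Finset.sum_range_succ', Finset.sum_range_succ]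
    have hsum' : ∑ k ∈ Finset.range L, f k = ∑ k ∈ Finset.range L,
        (wsq M.R (d.u (l + k) - M.us) + wsq M.Q (d.y (l + k) - M.ys)) := by
      refine Finset.sum_congr rfl fun k hk => ?_
      have := Finset.mem_range.1 hk
      simp only [f]
      rw [(hag (l + k) (by omega)).1, (hag (l + k) (by omega)).2]
    have hf0 : f 0 = wsq M.R (d.u l - M.us) + wsq M.Q (d.y l - M.ys) := by
      simp only [f, add_zero]
      rw [(hag l (by omega)).1, (hag l (by omega)).2]
    have hfL : f L = wsq (Kᵀ * M.R * K) (z - M.xis)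
        + wsq M.Q (E.Ct l *ᵥ z + E.Dt *ᵥ (M.us + K *ᵥ (z - M.xis)) - M.ys) := by
      simp only [f]
      rw [hu', hy', add_sub_cancel_left, wsq_transpose_mul_mul]
    -- Because the setpoint is a fixed point of the affine update, the deviation from it evolves
    -- linearly, as the terminal inequality requires.
    have hnext : window l u' y' (L + 1) - M.xis
        = (E.At l + E.Bt l * K) *ᵥ (z - M.xis) := by
      rw [hw']
      nth_rewrite 2 [xis_eq hE hlag heq]
      rw [add_mulVec, ← mulVec_mulVec, mulVec_add (E.Bt l), mulVec_sub (E.At l)]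
      abel
    have hdec := hterm.decrease z hf
    rw [← hnext] at hdec
    simp only [cost, window_shift, ← hz, add_comm 1 L]
    have hsh : ∀ k, 1 + (l + k) = l + (k + 1) := fun k => by omega
    simp only [hsh]
    rw [← hsum', ← hf0]
    change ∑ k ∈ Finset.range L, f (k + 1) + _ ≤ _
    linarith

/-- One step of the closed loop from a feasible extended state. -/
lemma ClosedLoop.step {l₀ : ℕ} (hcl : M.ClosedLoop S x u y)
    (hterm : M.TerminalIngredients E K) (hctrb : S.Controllable) (hlag : S.IsLag l₀)
    (hL : 1 ≤ L) (hE : E.Describes l S) (hdata : S.IsTrajectory N M.ud M.yd)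
    (heq : S.IsEquilibrium l₀ M.us M.ys) (hpe : PersistentlyExciting (L + l + n) N M.ud)
    {t : ℕ} (hfeas : M.Feasible (window l u y t)) :
    M.Feasible (window l u y (t + 1)) ∧ u (l + t) ∈ M.U ∧ y (l + t) ∈ M.Y ∧
      M.value (window l u y (t + 1)) ≤ M.value (window l u y t)
        - (wsq M.R (u (l + t) - M.us) + wsq M.Q (y (l + t) - M.ys)) := by
  obtain ⟨d, hd, hud⟩ := hcl.control t hfeas
  obtain ⟨hw, hy⟩ := hE.window_succ (t := t) (u := u) (y := y) ⟨x, fun k _ => hcl.plant k⟩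
  -- The prediction is a system trajectory with the same extended state and the same applied input
  -- as the plant, so its first output and next extended state are the true ones.
  obtain ⟨hw', hy'⟩ := hE.window_succ (t := 0) ((hd.1.isTrajectory hdata).mono (by omega))
  simp only [add_zero, zero_add] at hw' hy'
  rw [hd.1.init, ← hud] at hw' hy'
  have hwd : window l d.u d.y 1 = window l u y (t + 1) := hw'.trans hw.symm
  have hyd : y (l + t) = d.y l := hy.trans hy'.symm
  obtain ⟨d₁, hd₁, hcost⟩ := hterm.exists_successor hctrb hlag hL hE hdata heq hpe hd.1
  rw [hwd] at hd₁
  have hfeas₁ : M.Feasible (window l u y (t + 1)) := ⟨d₁, hd₁⟩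
  -- Only the existence of an optimizer at the next time matters here: it makes the value an
  -- attained minimum, comparable with the candidate's cost.
  obtain ⟨d₂, hd₂, -⟩ := hcl.control (t + 1) hfeas₁
  refine ⟨hfeas₁, ?_, ?_, ?_⟩
  · rw [hud]; exact hd.1.input 0 (by omega)
  · rw [hyd]; exact hd.1.output 0 (by omega)
  · rw [hd₂.value_eq, hd.value_eq, hud, hyd]
    exact (hd₂.2 d₁ hd₁).trans hcost

end MPC

end DDMPC

theorem theorem2 {n m p l L N l₀ : ℕ} (S : DDMPC.LTI n m p) (E : DDMPC.ARX m p)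
    (M : DDMPC.MPC m p l L N) (K : Matrix (Fin m) (DDMPC.ExtIdx l m p) ℝ)
    (hctrb : S.Controllable) (hobsv : S.Observable)
    (hlag : S.IsLag l₀) (hl : l₀ ≤ l) (hL : 1 ≤ L)
    (hE : E.Describes l S)
    (hdata : S.IsTrajectory N M.ud M.yd)
    (hQ : M.Q.PosDef) (hR : M.R.PosDef)
    (heq : S.IsEquilibrium l₀ M.us M.ys)
    (hint : (M.us, M.ys) ∈ interior (M.U ×ˢ M.Y))
    (hterm : M.TerminalIngredients E K)
    (hbound : M.QuadUpperBound)
    (hpe : DDMPC.PersistentlyExciting (L + l + n) N M.ud) :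
    (∀ x u y, M.ClosedLoop S x u y → M.Feasible (DDMPC.window l u y 0) →
      (∀ t : ℕ, M.Feasible (DDMPC.window l u y t)) ∧
      (∀ t : ℕ, u (l + t) ∈ M.U ∧ y (l + t) ∈ M.Y)) ∧
    M.ExponentiallyStable S := by
  have hfeas : ∀ x u y, M.ClosedLoop S x u y → M.Feasible (DDMPC.window l u y 0) →
      ∀ t : ℕ, M.Feasible (DDMPC.window l u y t) := by
    intro x u y hcl h0 t
    induction t with
    | zero => exact h0
    | succ t ih => exact (hcl.step hterm hctrb hlag hL hE hdata heq hpe ih).1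
  refine ⟨fun x u y hcl h0 => ⟨hfeas x u y hcl h0, fun t => ?_⟩, ?_, ?_⟩
  · have h := hcl.step hterm hctrb hlag hL hE hdata heq hpe (hfeas x u y hcl h0 t)
    exact ⟨h.2.1, h.2.2.1⟩
  · obtain ⟨δ, hδ, hmem⟩ := DDMPC.exists_norm2_lt_mem hterm.setpoint
    exact ⟨δ, hδ, fun u y htr hlt =>
      hterm.feasible hctrb hE hdata hpe htr (hmem _ hlt)⟩
  · obtain ⟨cR, hcR, hRle⟩ := DDMPC.exists_mul_norm2_sq_le_wsq hR
    obtain ⟨cQ, hcQ, hQle⟩ := DDMPC.exists_mul_norm2_sq_le_wsq hQ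
    obtain ⟨cu, hcu, hVle⟩ := hbound
    obtain ⟨C, q, hC, hq0, hq1, hdecay⟩ := DDMPC.exists_exponential_decay
      (hlag.1.1.trans hl) (lt_min hcR hcQ) hcu
    -- The decay estimate concerns squared norms, hence the square roots.
    refine ⟨√C, √q, Real.sqrt_pos.2 hC, Real.sqrt_pos.2 hq0,
      (Real.sqrt_lt' one_pos).2 (by simpa using hq1), fun x u y hcl h0 t => ?_⟩
    have hf := hfeas x u y hcl h0
    have hsq : ∀ t, DDMPC.norm2 (DDMPC.window l u y t - M.xis) ^ 2 =
        ∑ i ∈ Finset.range l, (DDMPC.norm2 (u (t + i) - M.us) ^ 2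
          + DDMPC.norm2 (y (t + i) - M.ys) ^ 2) :=
      DDMPC.norm2_window_sub_constExt_sq M.us M.ys
    -- Here `w` is the squared deviation of one input-output pair, so its window sums are the
    -- squared distances of the extended state to the setpoint, and `V` is the optimal value along
    -- the run.
    have h := hdecay
      (fun k => DDMPC.norm2 (u k - M.us) ^ 2 + DDMPC.norm2 (y k - M.ys) ^ 2)
      (fun t => M.value (DDMPC.window l u y t)) (fun k => by positivity)
      (fun t => by
        obtain ⟨d, hd, -⟩ := hcl.control t (hf t)
        rw [hd.value_eq]
        exact DDMPC.MPC.cost_nonneg hQ hR hterm.posDef d)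
      (fun t => by rw [← hsq]; exact hVle _ (hf t))
      (fun t => by
        have h1 := (hcl.step hterm hctrb hlag hL hE hdata heq hpe (hf t)).2.2.2
        have h2 := hRle (u (l + t) - M.us)
        have h3 := hQle (y (l + t) - M.ys)
        have h4 := mul_le_mul_of_nonneg_right (min_le_left cR cQ)
          (sq_nonneg (DDMPC.norm2 (u (l + t) - M.us)))
        have h5 := mul_le_mul_of_nonneg_right (min_le_right cR cQ)
          (sq_nonneg (DDMPC.norm2 (y (l + t) - M.ys)))
        linarith) t
    rw [← hsq, ← hsq] at h
    have hn := DDMPC.norm2_nonneg (DDMPC.window l u y 0 - M.xis)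
    refine (sq_le_sq₀ (DDMPC.norm2_nonneg _) (by positivity)).1 (h.trans_eq ?_)
    rw [mul_pow, mul_pow, Real.sq_sqrt hC.le, ← pow_mul, mul_comm t 2, pow_mul,
      Real.sq_sqrt hq0.le]
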